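/- Let $p$ be a prime and let $R$ be a (noetherian) regular commutative ring of characteristic $p$ that is $F$-finite, i.e. the Frobenius $F\colon R\to R$, $r\mapsto r^p$, is a finite ring map. Let $D_R\subseteq \operatorname{End}_{\mathbb Z}(R)$ be the ring of (Grothendieck) differential operators of $R$; for $f\ge 0$ let $D_R^{(f)}$ be the ring of those operators in $D_R$ that are linear over the subring $R^{p^f}$ of $p^f$-th powers. For a left $D_R$-module $M$ let $T^f(M)\subseteq M$ be the set of all $m$ with $\delta m=0$ for every $\delta\in D_R^{(f)}$ such that $\delta(1)=0$. Let $e\ge 0$ and let $F^{e*}M=R\otimes_{F^e}M$ be the pullback of the $R$-module $M$ along $F^e\colon R\to R$, $r\mapsto r^{p^e}$. Then for every $D_R$-module $M$ there is exactly one $D_R$-module structure on $F^{e*}M$ which extends its $R$-module structure and satisfies $\delta\cdot(r\otimes m)=\delta(r)\otimes m$ for all $f\ge 0$, $\delta\in D_R^{(e+f)}$, $r\in R$ and $m\in T^f(M)$. For every $D_R$-linear map $\varphi\colon M\to M'$ the map $F^{e*}\varphi=\mathrm{id}_R\otimes\varphi$ is $D_R$-linear for these structures, and the resulting functor $F^{e*}$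 from the category of $D_R$-modules to itself is an equivalence of categories. -/

import Mathlib

universe u v w

open CategoryTheory

noncomputable section

namespace FrobDescent

section DifferentialOperators

variable (R : Type u) [CommRing R]

/-- Additive endomorphisms of `R` that are differential operators of order at most `n` in the sense
of Grothendieck: `δ` has order at most `0` if it commutes with all multiplications, and order at
most `n + 1` if all its commutators with multiplications have order at most `n`. -/
def IsDiffOp : ℕ → Module.End ℤ R → Prop
  | 0, δ => ∀ r : R, δ * LinearMap.mulLeft ℤ r - LinearMap.mulLeft ℤ r * δ = 0
  | n + 1, δ => ∀ r : R, IsDiffOp n (δ * LinearMap.mulLeft ℤ r - LinearMap.mulLeft ℤ r * δ)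

variable {R}

theorem isDiffOp_zero (n : ℕ) : IsDiffOp R n 0 := by
  induction n with
  | zero => intro r; simp
  | succ n ih => intro r; simpa using ih

theorem IsDiffOp.succ {n : ℕ} {δ : Module.End ℤ R} (h : IsDiffOp R n δ) : IsDiffOp R (n + 1) δ := by
  induction n generalizing δ with
  | zero => intro r; rw [h r]; exact isDiffOp_zero 0
  | succ n ih => intro r; exact ih (h r)

theorem IsDiffOp.mono {m n : ℕ} (hmn : m ≤ n) {δ : Module.End ℤ R} (h : IsDiffOp R m δ) :
    IsDiffOp R n δ := by
  induction hmn with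
  | refl => exact h
  | step _ ih => exact ih.succ

theorem IsDiffOp.add {n : ℕ} {δ ε : Module.End ℤ R} (hδ : IsDiffOp R n δ) (hε : IsDiffOp R n ε) :
    IsDiffOp R n (δ + ε) := by
  induction n generalizing δ ε with
  | zero =>
    intro r
    have h := congrArg₂ (· + ·) (hδ r) (hε r)
    simp only [add_zero] at h
    rw [← h]; noncomm_ring
  | succ n ih =>
    intro r
    have h := ih (hδ r) (hε r)
    convert h using 1
    noncomm_ring

theorem IsDiffOp.neg {n : ℕ} {δ : Module.End ℤ R} (hδ : IsDiffOp R n δ) : IsDiffOp R n (-δ) := by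
  induction n generalizing δ with
  | zero =>
    intro r
    rw [← neg_eq_zero, ← hδ r]; noncomm_ring
  | succ n ih =>
    intro r
    convert ih (hδ r) using 1
    noncomm_ring

theorem isDiffOp_mulLeft (r : R) : IsDiffOp R 0 (LinearMap.mulLeft ℤ r) := by
  intro s
  ext x
  simp [mul_left_comm]

theorem IsDiffOp.mul {m n : ℕ} {δ ε : Module.End ℤ R} (hδ : IsDiffOp R m δ)
    (hε : IsDiffOp R n ε) : IsDiffOp R (m + n) (δ * ε) := by
  have key : ∀ (r : R), δ * ε * LinearMap.mulLeft ℤ r - LinearMap.mulLeft ℤ r * (δ * ε) =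
      δ * (ε * LinearMap.mulLeft ℤ r - LinearMap.mulLeft ℤ r * ε) +
      (δ * LinearMap.mulLeft ℤ r - LinearMap.mulLeft ℤ r * δ) * ε := by
    intro r; noncomm_ring
  induction hk : m + n generalizing m n δ ε with
  | zero =>
    obtain ⟨rfl, rfl⟩ : m = 0 ∧ n = 0 := by omega
    intro r
    rw [key r, hδ r, hε r]; simp
  | succ k ih =>
    intro r
    rw [key r]
    refine IsDiffOp.add ?_ ?_
    · cases n with
      | zero => rw [hε r, mul_zero]; exact isDiffOp_zero k
      | succ n => exact ih hδ (hε r) (fun _ => by noncomm_ring) (by omega)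
    · cases m with
      | zero => rw [hδ r, zero_mul]; exact isDiffOp_zero k
      | succ m => exact ih (hδ r) hε (fun _ => by noncomm_ring) (by omega)

variable (R)

/-- The ring `D_R` of (absolute) differential operators of `R`. -/
def diffOp : Subring (Module.End ℤ R) where
  carrier := {δ | ∃ n, IsDiffOp R n δ}
  mul_mem' := fun ⟨_, hm⟩ ⟨_, hn⟩ => ⟨_, hm.mul hn⟩
  one_mem' := ⟨0, fun r => by simp⟩
  add_mem' := fun ⟨m, hm⟩ ⟨n, hn⟩ =>
    ⟨max m n, (hm.mono (le_max_left m n)).add (hn.mono (le_max_right m n))⟩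
  zero_mem' := ⟨0, isDiffOp_zero 0⟩
  neg_mem' := fun ⟨n, hn⟩ => ⟨n, hn.neg⟩

/-- The inclusion `R → D_R`; an element acts by multiplication. -/
def ofRing : R →+* diffOp R where
  toFun r := ⟨LinearMap.mulLeft ℤ r, 0, isDiffOp_mulLeft r⟩
  map_one' := by ext x; simp
  map_mul' r s := by ext x; simp
  map_zero' := by ext x; simp
  map_add' r s := by ext x; simp [add_mul]

/-- The underlying `R`-module of a `D_R`-module. -/
abbrev toRMod : ModuleCat.{w} (diffOp R) ⥤ ModuleCat.{w} R := ModuleCat.restrictScalars (ofRing R)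

end DifferentialOperators

section Tensor

/-- The pure tensor `s ⊗ m` in the extension of scalars `S ⊗_R M` along `f : R → S`. (This is stated
for two rings, so that for `R = S` the left factor carries the structure twisted by `f`.) -/
def pureTensor {R : Type u} {S : Type v} [CommRing R] [CommRing S] (f : R →+* S)
    {M : ModuleCat.{w} R} (s : S) (m : M) : (ModuleCat.extendScalars f).obj M :=
  TensorProduct.tmul R (M := (ModuleCat.restrictScalars f).obj (ModuleCat.of S S)) s m

end Tensor

variable (R : Type u) [CommRing R] (p : ℕ) [Fact p.Prime] [CharP R p]

/-- Membership of an operator in `D_R^{(e)} = End_{R^{p^e}}(R)`: linearity over the subring of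
`p^e`-th powers. -/
def HasLevel (e : ℕ) (δ : diffOp R) : Prop :=
  ∀ s x : R, δ.1 (s ^ p ^ e * x) = s ^ p ^ e * δ.1 x

/-- Membership of `m` in `T^f(M) = Ann_M(J_f)`, where `J_f` is the left ideal of `D_R^{(f)}`
consisting of the operators `δ` with `δ(1) = 0`. -/
def IsHorizontal (f : ℕ) {M : ModuleCat.{w} (diffOp R)} (m : M) : Prop :=
  ∀ δ : diffOp R, HasLevel R p f δ → δ.1 1 = 0 → δ • m = 0

/-- The Frobenius pullback `F^{e*} M = R ⊗_{F^e} M`, with its `R`-module structure. -/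
abbrev frobPullback (e : ℕ) : ModuleCat.{max u v} R ⥤ ModuleCat.{max u v} R :=
  ModuleCat.extendScalars.{u, u, max u v} (iterateFrobenius R p e)

/-- The natural `D_R`-module structures on `F^{e*} M`, for a `D_R`-module `M`: those that extend the
`R`-module structure and in which an operator `δ ∈ D_R^{(e+f)}` acts as `δ ⊗ id` on the tensors
`r ⊗ m` with `m ∈ T^f(M)`, that is, through `F^{e*} M = F^{e*} F^{f*} N = F^{(e+f)*} N` for
`N = T^f(M)`. -/
@[ext]
structure NaturalStructure (e : ℕ) (M : ModuleCat.{max u v} (diffOp R)) where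
  /-- The action of `D_R`. -/
  toModule : Module (diffOp R) ((frobPullback.{u, v} R p e).obj ((toRMod R).obj M))
  ofRing_smul : ∀ (r : R) (x : (frobPullback.{u, v} R p e).obj ((toRMod R).obj M)),
    toModule.smul (ofRing R r) x = r • x
  smul_tensor : ∀ (f : ℕ) (δ : diffOp R) (r : R) (m : M),
    HasLevel R p (e + f) δ → IsHorizontal R p f m →
    toModule.smul δ (pureTensor (iterateFrobenius R p e) (M := (toRMod R).obj M) r m) =
      pureTensor (iterateFrobenius R p e) (M := (toRMod R).obj M) (δ.1 r) m

variable {R p}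

/-- `F^{e*} M` as a `D_R`-module. -/
def NaturalStructure.obj {e : ℕ} {M : ModuleCat.{max u v} (diffOp R)}
    (S : NaturalStructure.{u, v} R p e M) : ModuleCat.{max u v} (diffOp R) :=
  letI := S.toModule
  ModuleCat.of (diffOp R) ((frobPullback.{u, v} R p e).obj ((toRMod R).obj M))

/-- For all `D_R`-linear `φ : M → M'`, the map `F^{e*} φ = id ⊗ φ` is `D_R`-linear. -/
def IsFunctorial {e : ℕ} (S : ∀ M, NaturalStructure.{u, v} R p e M) : Prop :=
  ∀ ⦃M M' : ModuleCat.{max u v} (diffOp R)⦄ (φ : M ⟶ M') (δ : diffOp R)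
    (x : (frobPullback.{u, v} R p e).obj ((toRMod R).obj M)),
    ((frobPullback.{u, v} R p e).map ((toRMod R).map φ)).hom ((S M).toModule.smul δ x) =
      (S M').toModule.smul δ (((frobPullback.{u, v} R p e).map ((toRMod R).map φ)).hom x)

/-- The functor `F^{e*}` from `D_R`-modules to `D_R`-modules. -/
def frobFunctor {e : ℕ} (S : ∀ M, NaturalStructure.{u, v} R p e M) (hS : IsFunctorial S) :
    ModuleCat.{max u v} (diffOp R) ⥤ ModuleCat.{max u v} (diffOp R) where
  obj M := (S M).obj
  map {M M'} φ :=
    letI := (S M).toModule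
    letI := (S M').toModule
    ModuleCat.ofHom
      { toFun := ((frobPullback.{u, v} R p e).map ((toRMod R).map φ)).hom
        map_add' := map_add _
        map_smul' := hS φ }
  map_id M := by
    ext x
    change ((frobPullback.{u, v} R p e).map ((toRMod R).map (𝟙 M))).hom x = x
    simp
  map_comp {M M' M''} φ ψ := by
    ext x
    change ((frobPullback.{u, v} R p e).map ((toRMod R).map (φ ≫ ψ))).hom x =
      ((frobPullback.{u, v} R p e).map ((toRMod R).map ψ)).hom
        (((frobPullback.{u, v} R p e).map ((toRMod R).map φ)).hom x)
    rw [Functor.map_comp, Functor.map_comp]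
    rfl

end FrobDescent

end

/-! Write q = p^e. The key fact is that R is finite projective over itself along F^e. Flatness is
the case of Kunz's theorem in `frobenius_flat`: the maximal ideal of a regular local ring is
generated by a regular sequence, and the p-th powers of its members again form one. A dual basis
then provides elements x_i and p^{-e}-linear maps l_i with s = ∑ l_i(s)^q x_i. Moreover,
F-finiteness makes D_R the union of the rings of R^{p^f}-linear operators.

Operators thus act like matrices: δ sends r ⊗ m to ∑ x_i ⊗ δ_i m, where δ_i(a) = l_i(δ(r a^q)) lies
again in D_R (`entry`, `act_mul`). This action is forced, because a dual basis of F^f writes every m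
as an R-combination of elements of T^f(M) (`DualBasis.sum_gen_mul_conj`).

The equivalence is of Morita type. A p^{-e}-linear σ with σ(1) = 1 gives a nonunital ring map D_R →
D_R, δ ↦ (a ↦ δ(σ a)^q) (`conj`); let π be the image of 1, an idempotent. Then N descends to πN,
with r ⊗ n ↦ r n an isomorphism (`counit_bijective`), and on F^{e*} M the projector π cuts out the
tensors 1 ⊗ m. -/

namespace FrobDescent

/-! ### Powers of weakly regular sequences -/

section RegularSequences

open RingTheory.Sequence Function Pointwise

variable {R : Type*} [CommRing R]

/-- As r is regular on C, the sequence stays short exact modulo r, so induction on the list applies.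
-/
theorem isWeaklyRegular_of_exact {rs : List R} {A B C : Type*} [AddCommGroup A] [AddCommGroup B]
    [AddCommGroup C] [Module R A] [Module R B] [Module R C] {f : A →ₗ[R] B} {g : B →ₗ[R] C}
    (hf : Injective f) (hfg : Exact f g) (hg : Surjective g)
    (hA : IsWeaklyRegular A rs) (hC : IsWeaklyRegular C rs) : IsWeaklyRegular B rs := by
  induction rs generalizing A B C with
  | nil => exact IsWeaklyRegular.nil R B
  | cons r rs ih =>
    rw [isWeaklyRegular_cons_iff] at hA hC ⊢
    have key : ∀ b : B, g (r • b) = 0 → ∃ a, f a = b := fun b hb =>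
      (hfg b).1 (hC.1.right_eq_zero_of_smul (by rwa [map_smul] at hb))
    refine ⟨IsSMulRegular.of_right_eq_zero_of_smul fun b hb => ?_,
      ih ?_ (QuotSMulTop.map_exact r hfg hg) (QuotSMulTop.map_surjective r hg) hA.2 hC.2⟩
    · obtain ⟨a, rfl⟩ := key b (by rw [hb, map_zero])
      rw [← map_smul, map_eq_zero_iff f hf] at hb
      rw [hA.1.right_eq_zero_of_smul hb, map_zero]
    · rw [injective_iff_map_eq_zero]
      intro a ha
      obtain ⟨a, rfl⟩ := Submodule.mkQ_surjective _ a
      have ha' : f a ∈ r • (⊤ : Submodule R B) := (Submodule.Quotient.mk_eq_zero _).1 ha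
      obtain ⟨b, -, hb⟩ := (Submodule.mem_smul_pointwise_iff_exists _ _ _).1 ha'
      obtain ⟨a', rfl⟩ := key b (by rw [hb]; exact (hfg (f a)).2 ⟨a, rfl⟩)
      rw [← map_smul] at hb
      rw [← hf hb]
      exact (Submodule.Quotient.mk_eq_zero _).2
        (Submodule.smul_mem_pointwise_smul _ _ _ Submodule.mem_top)

/-- Induction along 0 → M/xⁿM → M/xⁿ⁺¹M → M/xM → 0, whose first map is multiplication by x. -/
theorem IsWeaklyRegular.pow_head {x : R} {rs : List R} {M : Type*} [AddCommGroup M] [Module R M]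
    (h : IsWeaklyRegular M (x :: rs)) (n : ℕ) : IsWeaklyRegular M (x ^ n :: rs) := by
  rw [isWeaklyRegular_cons_iff] at h ⊢
  obtain ⟨hx, h⟩ := h
  refine ⟨hx.pow n, ?_⟩
  induction n with
  | zero =>
    have hs : Subsingleton (QuotSMulTop (x ^ 0) M) := by
      rw [pow_zero]
      refine Submodule.Quotient.subsingleton_iff.2 ?_
      simp
    -- Every quotient of the zero module is zero; a fixed model keeps the induction on one module.
    have : IsWeaklyRegular PUnit.{1} rs := by
      clear h
      induction rs with
      | nil => exact IsWeaklyRegular.nil R _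
      | cons r rs ih =>
        refine (isWeaklyRegular_cons_iff _ _ _).2 ⟨fun _ _ _ => Subsingleton.elim _ _, ?_⟩
        exact (LinearEquiv.isWeaklyRegular_congr
          (LinearEquiv.ofSubsingleton PUnit.{1} (QuotSMulTop r PUnit.{1})) rs).1 ih
    exact (LinearEquiv.isWeaklyRegular_congr
          (LinearEquiv.ofSubsingleton PUnit.{1} (QuotSMulTop (x ^ 0) M)) rs).1 this
  | succ n ih =>
    let f : QuotSMulTop (x ^ n) M →ₗ[R] QuotSMulTop (x ^ (n + 1)) M :=
      Submodule.mapQ _ _ (LinearMap.lsmul R M x) (by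
        intro m hm
        obtain ⟨m', -, rfl⟩ := (Submodule.mem_smul_pointwise_iff_exists _ _ _).1 hm
        refine (Submodule.mem_smul_pointwise_iff_exists _ _ _).2 ⟨m', Submodule.mem_top, ?_⟩
        simp [smul_smul, pow_succ])
    let g : QuotSMulTop (x ^ (n + 1)) M →ₗ[R] QuotSMulTop x M :=
      Submodule.mapQ _ _ LinearMap.id (by
        intro m hm
        obtain ⟨m', -, rfl⟩ := (Submodule.mem_smul_pointwise_iff_exists _ _ _).1 hm
        refine (Submodule.mem_smul_pointwise_iff_exists _ _ _).2 ⟨x ^ n • m', Submodule.mem_top, ?_⟩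
        simp [smul_smul, pow_succ'])
    refine isWeaklyRegular_of_exact (f := f) (g := g) ?_ ?_ ?_ ih h
    · rw [injective_iff_map_eq_zero]
      intro a ha
      obtain ⟨a, rfl⟩ := Submodule.mkQ_surjective _ a
      have ha' : x • a ∈ x ^ (n + 1) • (⊤ : Submodule R M) := (Submodule.Quotient.mk_eq_zero _).1 ha
      obtain ⟨b, -, hb⟩ := (Submodule.mem_smul_pointwise_iff_exists _ _ _).1 ha'
      rw [pow_succ', mul_smul] at hb
      rw [← hx hb]
      exact (Submodule.Quotient.mk_eq_zero _).2
        (Submodule.smul_mem_pointwise_smul _ _ _ Submodule.mem_top)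
    · intro b
      obtain ⟨b, rfl⟩ := Submodule.mkQ_surjective _ b
      constructor
      · intro hb
        have hb' : b ∈ x • (⊤ : Submodule R M) := (Submodule.Quotient.mk_eq_zero _).1 hb
        obtain ⟨c, -, rfl⟩ := (Submodule.mem_smul_pointwise_iff_exists _ _ _).1 hb'
        exact ⟨Submodule.mkQ _ c, rfl⟩
      · rintro ⟨a, ha⟩
        obtain ⟨a, rfl⟩ := Submodule.mkQ_surjective _ a
        rw [← ha]
        exact (Submodule.Quotient.mk_eq_zero _).2
          (Submodule.smul_mem_pointwise_smul _ _ _ Submodule.mem_top)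
    · intro c
      obtain ⟨c, rfl⟩ := Submodule.mkQ_surjective _ c
      exact ⟨Submodule.mkQ _ c, rfl⟩

theorem IsWeaklyRegular.map_pow {rs : List R} {M : Type*} [AddCommGroup M] [Module R M]
    (h : IsWeaklyRegular M rs) (n : ℕ) : IsWeaklyRegular M (rs.map (· ^ n)) := by
  induction rs generalizing M with
  | nil => exact IsWeaklyRegular.nil R M
  | cons r rs ih =>
    rw [isWeaklyRegular_cons_iff] at h
    exact IsWeaklyRegular.pow_head ((isWeaklyRegular_cons_iff _ _ _).2 ⟨h.1, ih h.2⟩) n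

end RegularSequences

/-! ### Regular local rings: domains with regular generators of the maximal ideal -/

section RegularLocal

open RingTheory.Sequence Function Pointwise IsLocalRing

/-- A finite module is free if the maximal ideal is generated by a regular sequence on it. -/
theorem free_of_isWeaklyRegular {R : Type u} [CommRing R] [IsLocalRing R] [IsNoetherianRing R]
    {M : Type w} [AddCommGroup M] [Module R M] [Module.Finite R M] {rs : List R}
    (hrs : Ideal.ofList rs = maximalIdeal R) (h : IsWeaklyRegular M rs) : Module.Free R M := by
  induction hn : rs.length generalizing R M rs with
  | zero =>
    obtain rfl := List.length_eq_zero_iff.1 hn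
    have hR : IsField R := isField_iff_maximalIdeal_eq.2 (by rw [← hrs, Ideal.ofList_nil])
    let := hR.toField
    exact Module.Free.of_divisionRing R M
  | succ n ih =>
    obtain ⟨x, rs, rfl⟩ := List.exists_cons_of_length_eq_add_one hn
    have hx : x ∈ maximalIdeal R := by
      rw [← hrs]; exact Ideal.subset_span (by simp)
    rw [isWeaklyRegular_cons_iff'] at h
    have hne : Ideal.span {x} ≠ ⊤ := by
      intro h1
      have h2 := (Ideal.span_singleton_le_iff_mem (maximalIdeal R)).2 hx
      rw [h1, top_le_iff] at h2
      exact (maximalIdeal.isMaximal R).ne_top h2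
    have : Nontrivial (R ⧸ Ideal.span {x}) := Ideal.Quotient.nontrivial_iff.2 hne
    have : IsLocalRing (R ⧸ Ideal.span {x}) :=
      IsLocalRing.of_surjective' (Ideal.Quotient.mk _) Ideal.Quotient.mk_surjective
    have hfin : Module.Finite (R ⧸ Ideal.span {x}) (QuotSMulTop x M) :=
      Module.Finite.of_restrictScalars_finite R _ _
    have hm : Ideal.ofList (rs.map (Ideal.Quotient.mk (Ideal.span {x}))) =
        maximalIdeal (R ⧸ Ideal.span {x}) := by
      rw [← map_maximalIdeal_of_surjective _ Ideal.Quotient.mk_surjective, ← hrs,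
        Ideal.ofList_cons, Ideal.map_sup, Ideal.map_ofList, Ideal.map_quotient_self, bot_sup_eq]
    have hfree := ih hm h.2 (by simpa using hn)
    have : Module.FinitePresentation R M := Module.finitePresentation_of_finite R M
    -- Freeness lifts from M/xM because x is M-regular and lies in the Jacobson radical.
    refine (Module.free_quotSMulTop_iff_free R M ?_ h.1).1 hfree
    rwa [jacobson_eq_maximalIdeal _ bot_ne_top]

variable (R : Type u) [CommRing R]

/-- Since x is not in 𝔪², it can replace a minimal generator of 𝔪, so the embedding dimension drops
by one, while the Krull dimension drops by at most one. -/
theorem isRegularLocalRing_quotient [IsRegularLocalRing R] {x : R} (hx : x ∈ maximalIdeal R)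
    (hx2 : x ∉ maximalIdeal R ^ 2) {n : ℕ} (hn : ringKrullDim R = (n + 1 : ℕ)) :
    IsRegularLocalRing (R ⧸ Ideal.span {x}) ∧ ringKrullDim (R ⧸ Ideal.span {x}) = n := by
  classical
  have hne : Ideal.span {x} ≠ ⊤ := by
    intro h1
    have h2 := (Ideal.span_singleton_le_iff_mem (maximalIdeal R)).2 hx
    rw [h1, top_le_iff] at h2
    exact (maximalIdeal.isMaximal R).ne_top h2
  have : Nontrivial (R ⧸ Ideal.span {x}) := Ideal.Quotient.nontrivial_iff.2 hne
  have : IsLocalRing (R ⧸ Ideal.span {x}) :=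
    IsLocalRing.of_surjective' (Ideal.Quotient.mk _) Ideal.Quotient.mk_surjective
  have hcard : (maximalIdeal R).spanFinrank = n + 1 := by
    have h := IsRegularLocalRing.spanFinrank_maximalIdeal (R := R)
    rw [hn] at h
    exact_mod_cast h
  obtain ⟨s, hs, hspan⟩ := Submodule.FG.exists_span_finset_card_eq_spanFinrank
    (IsNoetherian.noetherian (maximalIdeal R))
  have hxs : x ∈ Submodule.span R (s : Set R) := by rw [hspan]; exact hx
  obtain ⟨c, -, hc⟩ := Submodule.mem_span_finset.1 hxs
  -- If all coefficients of x were in 𝔪, then x would be in 𝔪².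
  obtain ⟨a, has, ha⟩ : ∃ a ∈ s, c a ∉ maximalIdeal R := by
    by_contra! hcon
    refine hx2 ?_
    rw [← hc, pow_two]
    refine Ideal.sum_mem _ fun a ha => Ideal.mul_mem_mul (hcon a ha) ?_
    rw [← hspan]
    exact Submodule.subset_span ha
  obtain ⟨b, hb⟩ : IsUnit (c a) := by
    simpa using ha
  have hmap : maximalIdeal (R ⧸ Ideal.span {x}) =
      Ideal.span (((s.erase a).image (Ideal.Quotient.mk (Ideal.span {x})) : Finset _) : Set _) := by
    rw [← map_maximalIdeal_of_surjective _ Ideal.Quotient.mk_surjective, ← hspan]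
    change Ideal.map _ (Ideal.span _) = _
    rw [Ideal.map_span]
    refine le_antisymm (Ideal.span_le.2 ?_) (Ideal.span_mono ?_)
    · rintro _ ⟨y, hy, rfl⟩
      by_cases hya : y = a
      · subst hya
        have h1 : (Ideal.Quotient.mk (Ideal.span {x})) y =
            -(Ideal.Quotient.mk (Ideal.span {x}) (b⁻¹ : Rˣ)) *
              ∑ z ∈ s.erase y, Ideal.Quotient.mk (Ideal.span {x}) (c z) *
                Ideal.Quotient.mk (Ideal.span {x}) z := by
          have h2 : ((b⁻¹ : Rˣ) : R) * x = y + (b⁻¹ : Rˣ) * ∑ z ∈ s.erase y, c z * z := by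
            rw [← hc, ← Finset.add_sum_erase _ _ has, mul_add, smul_eq_mul, ← hb]
            simp
          have h3 := congrArg (Ideal.Quotient.mk (Ideal.span {x})) h2
          rw [map_mul, Ideal.Quotient.eq_zero_iff_mem.2 (Ideal.mem_span_singleton_self x),
            mul_zero, map_add, map_mul, map_sum] at h3
          simp only [map_mul] at h3
          linear_combination -h3
        rw [h1]
        refine Ideal.mul_mem_left _ _ (Ideal.sum_mem _ fun z hz => Ideal.mul_mem_left _ _ ?_)
        exact Ideal.subset_span (by
          rw [Finset.coe_image]; exact ⟨z, hz, rfl⟩)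
      · refine Ideal.subset_span ?_
        rw [Finset.coe_image]
        exact ⟨y, Finset.mem_coe.2 (Finset.mem_erase.2 ⟨hya, hy⟩), rfl⟩
    · rw [Finset.coe_image]
      exact Set.image_mono (Finset.coe_subset.2 (Finset.erase_subset _ _))
  have hle : (maximalIdeal (R ⧸ Ideal.span {x})).spanFinrank ≤ n := by
    rw [hmap]
    refine (Submodule.spanFinrank_span_le_ncard_of_finite (Finset.finite_toSet _)).trans ?_
    rw [Set.ncard_coe_finset]
    refine Finset.card_image_le.trans ?_
    rw [Finset.card_erase_of_mem has]
    omega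
  have hdim : (n : WithBot ℕ∞) ≤ ringKrullDim (R ⧸ Ideal.span {x}) := by
    have h := ringKrullDim_le_ringKrullDim_quotient_add_card (R := R) (s := {x}) (by
      rw [IsLocalRing.ringJacobson_eq_maximalIdeal]; simpa using hx)
    rw [Finset.coe_singleton, hn] at h
    generalize ringKrullDim (R ⧸ Ideal.span {x}) = d at h ⊢
    induction d with
    | bot => simp at h
    | coe d =>
      induction d with
      | top => exact le_top
      | coe d =>
        simp only [Finset.card_singleton] at h
        have : n + 1 ≤ d + 1 := by exact_mod_cast h
        exact_mod_cast Nat.le_of_succ_le_succ this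
  have hreg : IsRegularLocalRing (R ⧸ Ideal.span {x}) :=
    IsRegularLocalRing.of_spanFinrank_maximalIdeal_le _
      (le_trans (by exact_mod_cast hle) hdim)
  refine ⟨hreg, le_antisymm ?_ hdim⟩
  rw [← hreg.spanFinrank_maximalIdeal]
  exact_mod_cast hle

/-- By Nakayama, 𝔪 = 𝔪² would make R a field, of dimension 0. -/
theorem maximalIdeal_sq_ne [IsLocalRing R] [IsNoetherianRing R] {n : ℕ}
    (hn : ringKrullDim R = (n + 1 : ℕ)) : ¬ maximalIdeal R ≤ maximalIdeal R ^ 2 := by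
  intro h
  have hbot : maximalIdeal R = ⊥ := by
    refine Submodule.eq_bot_of_le_smul_of_le_jacobson_bot (maximalIdeal R) _
      (IsNoetherian.noetherian _) ?_ (by rw [jacobson_eq_maximalIdeal _ bot_ne_top])
    rwa [smul_eq_mul, ← pow_two]
  have h0 := ringKrullDim_eq_zero_of_isField (isField_iff_maximalIdeal_eq.2 hbot)
  rw [hn] at h0
  have : n + 1 = 0 := by exact_mod_cast h0
  omega

/-- Choose x in 𝔪 outside 𝔪² and all minimal primes. By induction (x) is prime; a minimal prime P
inside it does not contain x, so P = xP and P = 0 by Nakayama. -/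
theorem isDomain_of_ringKrullDim_eq {R : Type u} [CommRing R] [IsRegularLocalRing R] {n : ℕ}
    (hn : ringKrullDim R = n) : IsDomain R := by
  induction n generalizing R with
  | zero =>
    have h := IsRegularLocalRing.spanFinrank_maximalIdeal (R := R)
    rw [hn] at h
    have hbot := (Submodule.spanFinrank_eq_zero_iff_eq_bot
      (IsNoetherian.noetherian (maximalIdeal R))).1 (by exact_mod_cast h)
    exact (isField_iff_maximalIdeal_eq.2 hbot).isDomain
  | succ n ih =>
    obtain ⟨x, hx, hx2⟩ : ∃ x ∈ maximalIdeal R,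
        x ∉ ⋃ I ∈ insert (maximalIdeal R ^ 2) (minimalPrimes R), (I : Set R) := by
      by_contra! hcon
      -- Prime avoidance allows two nonprime ideals; 𝔪² fills both places.
      obtain ⟨I, hI, hle⟩ := (Ideal.subset_union_prime_finite
        ((minimalPrimes.finite_of_isNoetherianRing R).insert (maximalIdeal R ^ 2))
        (f := fun I => I) (maximalIdeal R ^ 2) (maximalIdeal R ^ 2) (fun I hI hne _ =>
          ((Set.mem_insert_iff.1 hI).resolve_left hne).1.1)).1 hcon
      rcases Set.mem_insert_iff.1 hI with rfl | hI
      · exact maximalIdeal_sq_ne R hn hle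
      · have hIp : I.IsPrime := hI.1.1
        have hIm : I = maximalIdeal R := le_antisymm (le_maximalIdeal hIp.ne_top) hle
        subst hIm
        have h1 := Ideal.height_eq_zero_iff.2 hI
        have h2 := maximalIdeal_height_eq_ringKrullDim (R := R)
        rw [h1, hn] at h2
        have : n + 1 = 0 := by exact_mod_cast h2.symm
        omega
    simp only [Set.mem_iUnion, not_exists, SetLike.mem_coe] at hx2
    obtain ⟨hreg, hd⟩ := isRegularLocalRing_quotient R hx (hx2 _ (Set.mem_insert _ _)) hn
    have hdom := ih hd
    have hprime : (Ideal.span {x}).IsPrime := (Ideal.Quotient.isDomain_iff_prime _).1 hdom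
    obtain ⟨P, hP, hPx⟩ := Ideal.exists_minimalPrimes_le (bot_le : (⊥ : Ideal R) ≤ Ideal.span {x})
    have hPp : P.IsPrime := hP.1.1
    have hxP : x ∉ P := hx2 P (Set.mem_insert_of_mem _ hP)
    have hbot : P = ⊥ := by
      refine Submodule.eq_bot_of_le_smul_of_le_jacobson_bot (Ideal.span {x}) _
        (IsNoetherian.noetherian _) ?_ ?_
      · intro y hy
        obtain ⟨z, rfl⟩ := Ideal.mem_span_singleton'.1 (hPx hy)
        rw [mul_comm]
        exact Submodule.smul_mem_smul (Ideal.mem_span_singleton_self x)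
          ((hPp.mem_or_mem hy).resolve_right hxP)
      · rw [jacobson_eq_maximalIdeal _ bot_ne_top]
        exact (Ideal.span_singleton_le_iff_mem _).2 hx
    rw [hbot] at hPp
    exact IsDomain.of_bot_isPrime R

/-- Any x in 𝔪 outside 𝔪² is regular because R is a domain; prepend it to lifts of a sequence for
R/(x). -/
theorem exists_isWeaklyRegular_of_ringKrullDim_eq {R : Type u} [CommRing R] [IsRegularLocalRing R]
    {n : ℕ} (hn : ringKrullDim R = n) :
    ∃ rs : List R, Ideal.ofList rs = maximalIdeal R ∧ IsWeaklyRegular R rs := by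
  induction n generalizing R with
  | zero =>
    have h := IsRegularLocalRing.spanFinrank_maximalIdeal (R := R)
    rw [hn] at h
    have hbot := (Submodule.spanFinrank_eq_zero_iff_eq_bot
      (IsNoetherian.noetherian (maximalIdeal R))).1 (by exact_mod_cast h)
    exact ⟨[], by rw [hbot, Ideal.ofList_nil], IsWeaklyRegular.nil R R⟩
  | succ n ih =>
    have := isDomain_of_ringKrullDim_eq hn
    obtain ⟨x, hx, hx2⟩ := SetLike.not_le_iff_exists.1 (maximalIdeal_sq_ne R hn)
    obtain ⟨hreg, hd⟩ := isRegularLocalRing_quotient R hx hx2 hn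
    obtain ⟨rs, hrs, hwr⟩ := ih hd
    obtain ⟨rs, rfl⟩ := List.map_surjective_iff.2 Ideal.Quotient.mk_surjective rs
    have hx0 : x ≠ 0 := by rintro rfl; exact hx2 (zero_mem _)
    refine ⟨x :: rs, ?_, (isWeaklyRegular_cons_iff _ _ _).2 ⟨?_, ?_⟩⟩
    · have h1 := congrArg (Ideal.comap (Ideal.Quotient.mk (Ideal.span {x}))) hrs
      rw [← Ideal.map_ofList, ← map_maximalIdeal_of_surjective _ Ideal.Quotient.mk_surjective,
        Ideal.comap_map_of_surjective' _ Ideal.Quotient.mk_surjective,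
        Ideal.comap_map_of_surjective' _ Ideal.Quotient.mk_surjective, Ideal.mk_ker,
        sup_of_le_left ((Ideal.span_singleton_le_iff_mem _).2 hx)] at h1
      rw [Ideal.ofList_cons, sup_comm, h1]
    · exact IsSMulRegular.of_right_eq_zero_of_smul fun y hy =>
        (mul_eq_zero.1 hy).resolve_left hx0
    · have h1 := (isWeaklyRegular_map_algebraMap_iff (R := R) (S := R ⧸ Ideal.span {x})
        (M := R ⧸ Ideal.span {x}) rs).1 hwr
      refine (LinearEquiv.isWeaklyRegular_congr
        (Submodule.quotEquivOfEq (Ideal.span {x}) (x • (⊤ : Ideal R)) ?_) rs).1 h1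
      simp [← Submodule.ideal_span_singleton_smul]

/-- The maximal ideal of a regular local ring is generated by a regular sequence. -/
theorem exists_isWeaklyRegular [IsRegularLocalRing R] :
    ∃ rs : List R, Ideal.ofList rs = maximalIdeal R ∧ IsWeaklyRegular R rs :=
  exists_isWeaklyRegular_of_ringKrullDim_eq IsRegularLocalRing.spanFinrank_maximalIdeal.symm

end RegularLocal

/-! ### Flatness of Frobenius -/

section Kunz

open RingTheory.Sequence IsLocalRing

theorem flat_of_isWeaklyRegular_map {R S : Type*} [CommRing R] [CommRing S] [IsLocalRing R]
    [IsNoetherianRing R] {f : R →+* S} (hf : f.Finite) {rs : List R}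
    (hrs : Ideal.ofList rs = maximalIdeal R) (h : IsWeaklyRegular S (rs.map f)) : f.Flat := by
  algebraize [f]
  have := free_of_isWeaklyRegular hrs
    ((isWeaklyRegular_map_algebraMap_iff (R := R) (S := S) (M := S) rs).1 h)
  change Module.Flat R S
  infer_instance

/-- Through Frobenius, each x_i acts as x_i^p, so the regular sequence stays regular on the target.
-/
theorem frobenius_flat_of_isRegularLocalRing (R : Type*) [CommRing R] (p : ℕ) [Fact p.Prime]
    [CharP R p] [IsRegularLocalRing R] (hF : (frobenius R p).Finite) : (frobenius R p).Flat := by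
  obtain ⟨rs, hrs, h⟩ := exists_isWeaklyRegular R
  exact flat_of_isWeaklyRegular_map hF hrs (IsWeaklyRegular.map_pow h p)

theorem finite_of_forall_exists_sum {R S ι : Type*} [CommRing R] [CommRing S] [Fintype ι]
    (f : R →+* S) (x : ι → S) (hx : ∀ s, ∃ c : ι → R, s = ∑ i, f (c i) * x i) : f.Finite := by
  algebraize [f]
  change Module.Finite R S
  refine Module.Finite.of_surjective (Fintype.linearCombination R x) fun s => ?_
  obtain ⟨c, hc⟩ := hx s
  exact ⟨c, by rw [hc, Fintype.linearCombination_apply]; simp [Algebra.smul_def]; rfl⟩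

theorem exists_sum_of_finite {R S : Type*} [CommRing R] [CommRing S]
    {f : R →+* S} (hf : f.Finite) :
    ∃ (n : ℕ) (x : Fin n → S), ∀ s, ∃ c : Fin n → R, s = ∑ i, f (c i) * x i := by
  algebraize [f]
  have : Module.Finite R S := hf
  obtain ⟨n, x, hx⟩ := Module.Finite.exists_fin (R := R) (M := S)
  refine ⟨n, x, fun s => ?_⟩
  obtain ⟨c, hc⟩ := (Submodule.mem_span_range_iff_exists_fun R).1
    (show s ∈ Submodule.span R (Set.range x) by rw [hx]; trivial)
  exact ⟨c, by rw [← hc]; simp [Algebra.smul_def]; rfl⟩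

theorem charP_of_natCast_eq_zero (A : Type*) [Ring A] [Nontrivial A] {p : ℕ} (hp : p.Prime)
    (h : (p : A) = 0) : CharP A p := by
  obtain ⟨q, hq⟩ := CharP.exists A
  rcases (Nat.dvd_prime hp).1 ((CharP.cast_eq_zero_iff A q p).1 h) with rfl | rfl
  · exact absurd rfl (CharP.char_ne_one A 1)
  · exact hq

/-- Frobenius is flat for `F`-finite regular rings. This case of a theorem of Kunz is proved by
reduction to regular local rings. -/
theorem frobenius_flat (R : Type*) [CommRing R] (p : ℕ) [Fact p.Prime]
    [CharP R p] [IsRegularRing R] (hF : (frobenius R p).Finite) : (frobenius R p).Flat := by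
  refine RingHom.Flat.ofLocalizationPrime _ fun P hP => ?_
  have key : ∀ (Q : Ideal R) [Q.IsPrime] (h : Q = P.comap (frobenius R p)),
      (Localization.localRingHom Q P (frobenius R p) h).Flat := by
    intro Q hQ h
    -- Primes are their own preimages under Frobenius, so the local map is the Frobenius of R_P.
    have hQP : Q = P := by
      rw [h]
      ext r
      rw [Ideal.mem_comap, frobenius_def]
      exact hP.pow_mem_iff_mem p (Fact.out : p.Prime).pos
    subst hQP
    have hchar : CharP (Localization.AtPrime Q) p :=
      charP_of_natCast_eq_zero _ (Fact.out : p.Prime) (by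
        rw [← map_natCast (algebraMap R (Localization.AtPrime Q)), CharP.cast_eq_zero, map_zero])
    rw [Localization.localRingHom_unique Q Q (frobenius R p) h
      (j := frobenius (Localization.AtPrime Q) p) (fun x => by simp [frobenius_def])]
    refine frobenius_flat_of_isRegularLocalRing _ p ?_
    obtain ⟨n, x, hx⟩ := exists_sum_of_finite hF
    refine finite_of_forall_exists_sum _ (fun i => algebraMap R _ (x i)) fun y => ?_
    obtain ⟨a, s, rfl⟩ := IsLocalization.exists_mk'_eq Q.primeCompl y
    -- From a/s = a s^{p-1}/s^p, the denominator becomes a p-th power and is absorbed by the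
    -- coefficients c_i/s.
    obtain ⟨c, hc⟩ := hx (a * s ^ (p - 1))
    refine ⟨fun i => IsLocalization.mk' _ (c i) s, ?_⟩
    have hs := IsLocalization.map_units (Localization.AtPrime Q) s
    rw [← (hs.pow p).mul_right_inj, Finset.mul_sum]
    have hl : algebraMap R (Localization.AtPrime Q) (s : R) ^ p * IsLocalization.mk' _ a s =
        algebraMap R (Localization.AtPrime Q) (a * s ^ (p - 1)) := by
      rw [← Nat.sub_add_cancel (Fact.out : p.Prime).one_le, pow_succ, mul_assoc, mul_comm _
        (IsLocalization.mk' _ a s), IsLocalization.mk'_spec, map_mul, map_pow, mul_comm,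
        Nat.add_sub_cancel]
    rw [hl, hc, map_sum]
    refine Finset.sum_congr rfl fun i _ => ?_
    rw [frobenius_def, frobenius_def, ← mul_assoc, ← mul_pow, mul_comm _
        (IsLocalization.mk' _ (c i) s), IsLocalization.mk'_spec, map_mul, map_pow]
  exact key _ rfl

theorem iterateFrobenius_finite (R : Type*) [CommRing R] (p : ℕ) [Fact p.Prime]
    [CharP R p] (hF : (frobenius R p).Finite) (e : ℕ) : (iterateFrobenius R p e).Finite := by
  induction e with
  | zero => rw [iterateFrobenius_zero]; exact RingHom.Finite.id R
  | succ e ih => rw [iterateFrobenius_add, iterateFrobenius_one]; exact ih.comp hF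

theorem iterateFrobenius_flat (R : Type*) [CommRing R] (p : ℕ) [Fact p.Prime]
    [CharP R p] (hF : (frobenius R p).Flat) (e : ℕ) : (iterateFrobenius R p e).Flat := by
  induction e with
  | zero => rw [iterateFrobenius_zero]; exact RingHom.Flat.id R
  | succ e ih => rw [iterateFrobenius_add, iterateFrobenius_one]; exact hF.comp ih

end Kunz

/-! ### Dual bases and Frobenius splittings -/

section DualBasis

/-- A finite dual basis of `S`, as a module over `R` along `f`. -/
structure DualBasis {R S : Type*} [CommRing R] [CommRing S] (f : R →+* S) where
  /-- The number of generators. -/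
  card : ℕ
  /-- The generators. -/
  gen : Fin card → S
  /-- The coordinate functions. -/
  coord : Fin card → S →+ R
  coord_mul : ∀ i a s, coord i (f a * s) = a * coord i s
  sum_coord : ∀ s, ∑ i, f (coord i s) * gen i = s

theorem nonempty_dualBasis {R S : Type*} [CommRing R] [CommRing S] [IsNoetherianRing R]
    {f : R →+* S} (hf : f.Finite) (hf' : f.Flat) : Nonempty (DualBasis f) := by
  algebraize [f]
  have h1 : Module.Finite R S := hf
  have h2 : Module.Flat R S := hf'
  have h3 : Module.FinitePresentation R S := Module.finitePresentation_of_finite R S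
  have h4 : Module.Projective R S := Module.Flat.projective_of_finitePresentation
  obtain ⟨n, g, h, -, -, hgh⟩ := Module.Finite.exists_comp_eq_id_of_projective R S
  refine ⟨⟨n, fun i => g (Pi.single i 1), fun i => ((LinearMap.proj i).comp h).toAddMonoidHom,
    fun i a s => ?_, fun s => ?_⟩⟩
  · have := congrFun (h.map_smul a s) i
    rwa [Algebra.smul_def] at this
  · conv_rhs => rw [← LinearMap.id_apply (R := R) s, ← hgh, LinearMap.comp_apply,
      ← Finset.univ_sum_single (h s), map_sum]
    refine Finset.sum_congr rfl fun i _ => ?_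
    have hi : Pi.single i (h s i) = h s i • (Pi.single i 1 : Fin n → R) := by
      rw [← Pi.single_smul, smul_eq_mul, mul_one]
    rw [hi, map_smul, Algebra.smul_def]
    rfl

variable {R : Type*} [CommRing R] {p : ℕ} [Fact p.Prime] [CharP R p] {e : ℕ}

/-- The coordinate functions of a dual basis yield a splitting of the iterated Frobenius. -/
theorem DualBasis.exists_splitting (B : DualBasis (iterateFrobenius R p e)) :
    ∃ σ : R →+ R, (∀ a s, σ (a ^ p ^ e * s) = a * σ s) ∧ σ 1 = 1 := by
  -- The values at 1 of p^{-e}-linear maps form an ideal. A maximal ideal containing it would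
  -- contain 1 = ∑ l_i(1)^q x_i.
  let I : Ideal R :=
    { carrier := {b | ∃ σ : R →+ R, (∀ a s, σ (a ^ p ^ e * s) = a * σ s) ∧ σ 1 = b}
      add_mem' := by
        rintro _ _ ⟨σ, h, rfl⟩ ⟨τ, h', rfl⟩
        exact ⟨σ + τ, fun a s => by simp [h, h', mul_add], rfl⟩
      zero_mem' := ⟨0, by simp, rfl⟩
      smul_mem' := by
        rintro c _ ⟨σ, h, rfl⟩
        exact ⟨(AddMonoidHom.mulLeft c).comp σ, fun a s => by simp [h, mul_left_comm], rfl⟩ }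
  suffices h : I = ⊤ from (Ideal.eq_top_iff_one I).1 h
  by_contra hI
  obtain ⟨m, hm, hle⟩ := Ideal.exists_le_maximal I hI
  refine hm.ne_top ((Ideal.eq_top_iff_one m).2 ?_)
  rw [← B.sum_coord 1]
  refine Ideal.sum_mem _ fun i _ => Ideal.mul_mem_right _ _ ?_
  rw [iterateFrobenius_def]
  refine Ideal.pow_mem_of_mem _ (hle ⟨B.coord i, fun a s => ?_, rfl⟩) _
    (pow_pos (Fact.out : p.Prime).pos _)
  rw [← B.coord_mul, iterateFrobenius_def]

end DualBasis

end FrobDescent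

namespace FrobDescent

/-! ### Differential operators as operators linear over p-power subrings -/

section Levels

variable {R : Type u} [CommRing R]

/-- The commutator of an operator with the multiplication by `r`. -/
def commutator (r : R) : Module.End ℤ (Module.End ℤ R) :=
  LinearMap.mulRight ℤ (LinearMap.mulLeft ℤ r) - LinearMap.mulLeft ℤ (LinearMap.mulLeft ℤ r)

theorem commutator_apply (r : R) (δ : Module.End ℤ R) :
    commutator r δ = δ * LinearMap.mulLeft ℤ r - LinearMap.mulLeft ℤ r * δ := rfl

theorem commutator_apply_apply (r : R) (δ : Module.End ℤ R) (x : R) :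
    commutator r δ x = δ (r * x) - r * δ x := rfl

theorem commute_commutator (r s : R) : Commute (commutator r) (commutator s) := by
  ext δ x
  simp only [Module.End.mul_apply, commutator_apply_apply]
  rw [mul_left_comm r s x, mul_sub, mul_sub, mul_left_comm r s (δ x)]
  abel

theorem IsDiffOp.commutator_pow {n : ℕ} {δ : Module.End ℤ R} (h : IsDiffOp R n δ) (r : R) :
    (commutator r ^ (n + 1)) δ = 0 := by
  induction n generalizing δ with
  | zero => rw [zero_add, pow_one]; exact h r
  | succ n ih => rw [pow_succ, Module.End.mul_apply]; exact ih (h r)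

theorem IsDiffOp.sum {ι : Type*} (s : Finset ι) {n : ℕ} {δ : ι → Module.End ℤ R}
    (h : ∀ i ∈ s, IsDiffOp R n (δ i)) : IsDiffOp R n (∑ i ∈ s, δ i) := by
  classical
  induction s using Finset.induction_on with
  | empty => simpa using isDiffOp_zero n
  | insert a s ha ih =>
    rw [Finset.sum_insert ha]
    exact (h a (Finset.mem_insert_self _ _)).add
      (ih fun i hi => h i (Finset.mem_insert_of_mem hi))

variable {p : ℕ}

theorem HasLevel.mono {e f : ℕ} (hef : e ≤ f) {δ : diffOp R} (h : HasLevel R p e δ) :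
    HasLevel R p f δ := by
  intro s x
  rw [← Nat.sub_add_cancel hef, pow_add, pow_mul]
  exact h _ _

/-- If `x` generates `R` over the `p ^ e`-th powers, then an operator which is linear over these and
is annihilated by powers of the commutators with the `x i` is a differential operator. -/
theorem isDiffOp_of_commutator_pow {e m : ℕ} {x : Fin m → R}
    (hx : ∀ r, ∃ c : Fin m → R, r = ∑ i, c i ^ p ^ e * x i) (k : Fin m → ℕ) {n : ℕ}
    (hn : ∑ i, k i = n) {δ : Module.End ℤ R}
    (hδ : ∀ s y : R, δ (s ^ p ^ e * y) = s ^ p ^ e * δ y)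
    (h : ∀ i, (commutator (x i) ^ k i) δ = 0) : IsDiffOp R n δ := by
  -- Linearity over q-th powers gives [δ, ∑ c_i^q x_i] = ∑ c_i^q [δ, x_i].
  have expand : ∀ {δ : Module.End ℤ R}, (∀ s y : R, δ (s ^ p ^ e * y) = s ^ p ^ e * δ y) →
      ∀ r, ∃ c : Fin m → R, commutator r δ =
        ∑ i, LinearMap.mulLeft ℤ (c i ^ p ^ e) * commutator (x i) δ := by
    intro δ hδ r
    obtain ⟨c, rfl⟩ := hx r
    refine ⟨c, ?_⟩
    ext y
    simp only [commutator_apply_apply, LinearMap.sum_apply, Module.End.mul_apply,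
      LinearMap.mulLeft_apply, Finset.sum_mul, map_sum]
    rw [← Finset.sum_sub_distrib]
    refine Finset.sum_congr rfl fun i _ => ?_
    rw [mul_assoc, hδ]
    ring
  have vanish : ∀ {δ : Module.End ℤ R} {i : Fin m} {k : ℕ}, k = 0 →
      (commutator (x i) ^ k) δ = 0 → δ = 0 := by
    rintro δ i _ rfl h0
    rwa [pow_zero, Module.End.one_apply] at h0
  induction n generalizing δ k with
  | zero =>
    intro r
    obtain ⟨c, hc⟩ := expand hδ r
    rw [← commutator_apply, hc]
    refine Finset.sum_eq_zero fun i _ => ?_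
    rw [vanish (Finset.sum_eq_zero_iff.1 hn i (Finset.mem_univ i)) (h i), map_zero, mul_zero]
  | succ n ih =>
    intro r
    obtain ⟨c, hc⟩ := expand hδ r
    rw [← commutator_apply, hc]
    refine IsDiffOp.sum _ fun i _ => ?_
    suffices hi : IsDiffOp R n (commutator (x i) δ) by
      simpa using (isDiffOp_mulLeft (c i ^ p ^ e)).mul hi
    by_cases hki : k i = 0
    · rw [vanish hki (h i), map_zero]
      exact isDiffOp_zero n
    -- Bracketing with x_i lowers k_i by one and keeps the other exponents, as the commutators
    -- commute.
    refine ih (Function.update k i (k i - 1)) ?_ (fun s y => ?_) fun j => ?_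
    · rw [Finset.sum_update_of_mem (Finset.mem_univ i)]
      rw [← Finset.add_sum_erase _ _ (Finset.mem_univ i), Finset.erase_eq] at hn
      omega
    · rw [commutator_apply_apply, commutator_apply_apply, mul_left_comm, hδ, hδ]
      ring
    · by_cases hj : j = i
      · subst hj
        rw [Function.update_self, ← Module.End.mul_apply, ← pow_succ,
          Nat.sub_add_cancel (Nat.one_le_iff_ne_zero.2 hki), h]
      · rw [Function.update_of_ne hj, ← Module.End.mul_apply,
          ((commute_commutator (x j) (x i)).pow_left _).eq, Module.End.mul_apply, h, map_zero]

variable (p : ℕ) [Fact p.Prime] [CharP R p]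

/-- The commutator is a difference of commuting right and left multiplications, so the p-power map
is additive on it in characteristic p. -/
theorem commutator_pow_prime_pow (r : R) (e : ℕ) :
    commutator r ^ p ^ e = commutator (r ^ p ^ e) := by
  have : Nontrivial R := CharP.nontrivial_of_char_ne_one (Fact.out : p.Prime).ne_one
  have hcast : (p : Module.End ℤ (Module.End ℤ R)) = 0 := by
    ext δ x
    rw [← nsmul_one]
    simp
  have : CharP (Module.End ℤ (Module.End ℤ R)) p :=
    charP_of_natCast_eq_zero _ (Fact.out : p.Prime) hcast
  have : ExpChar (Module.End ℤ (Module.End ℤ R)) p := ExpChar.prime Fact.out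
  have hcomm : Commute (LinearMap.mulRight ℤ (LinearMap.mulLeft ℤ r : Module.End ℤ R))
      (LinearMap.mulLeft ℤ (LinearMap.mulLeft ℤ r : Module.End ℤ R)) :=
    (LinearMap.commute_mulLeft_right _ _).symm
  rw [commutator, sub_pow_expChar_pow_of_commute p e hcomm, LinearMap.pow_mulRight,
    LinearMap.pow_mulLeft, LinearMap.pow_mulLeft, LinearMap.pow_mulLeft, commutator]

/-- A differential operator is linear over the `p ^ e`-th powers for large `e`. -/
theorem exists_hasLevel (δ : diffOp R) : ∃ e, HasLevel R p e δ := by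
  obtain ⟨δ, n, hn⟩ := δ
  -- An operator of order n dies after n + 1 commutators; any e with p^e ≥ n + 1 would serve.
  have hlt : n + 1 ≤ p ^ (n + 1) := (Nat.lt_pow_self (Fact.out : p.Prime).one_lt).le
  refine ⟨n + 1, fun s x => ?_⟩
  have h : commutator (s ^ p ^ (n + 1)) δ = 0 := by
    rw [← commutator_pow_prime_pow, ← Nat.sub_add_cancel hlt, pow_add, Module.End.mul_apply,
      hn.commutator_pow, map_zero]
  exact sub_eq_zero.1 (congrArg (fun ε : Module.End ℤ R => ε x) h)

variable {p}

/-- Operators that are linear over the `p ^ e`-th powers are differential operators. -/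
theorem mem_diffOp_of_pow_linear (hF : (frobenius R p).Finite) {e : ℕ} {δ : Module.End ℤ R}
    (hδ : ∀ s y : R, δ (s ^ p ^ e * y) = s ^ p ^ e * δ y) : δ ∈ diffOp R := by
  obtain ⟨m, x, hx⟩ := exists_sum_of_finite (iterateFrobenius_finite R p hF e)
  refine ⟨_, isDiffOp_of_commutator_pow hx (fun _ => p ^ e) rfl hδ fun i => ?_⟩
  rw [commutator_pow_prime_pow]
  ext y
  rw [commutator_apply_apply, hδ, sub_self, LinearMap.zero_apply]

end Levels

end FrobDescent

noncomputable section

namespace FrobDescent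

/-! ### Tensors along a ring map -/

section PureTensors

variable {R : Type u} {S : Type v} [CommRing R] [CommRing S] (f : R →+* S) {M : ModuleCat.{w} R}

theorem pureTensor_add_left (s t : S) (m : M) :
    pureTensor f (s + t) m = pureTensor f s m + pureTensor f t m :=
  TensorProduct.add_tmul (R := R) (M := (ModuleCat.restrictScalars f).obj (ModuleCat.of S S)) s t m

theorem pureTensor_add_right (s : S) (m n : M) :
    pureTensor f s (m + n) = pureTensor f s m + pureTensor f s n :=
  TensorProduct.tmul_add (R := R) (M := (ModuleCat.restrictScalars f).obj (ModuleCat.of S S)) s m n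

theorem pureTensor_map_mul (a : R) (s : S) (m : M) :
    pureTensor f (f a * s) m = pureTensor f s (a • m) :=
  TensorProduct.smul_tmul (R := R) (M := (ModuleCat.restrictScalars f).obj (ModuleCat.of S S)) a s m

theorem pureTensor_sum_left {ι : Type*} (A : Finset ι) (s : ι → S) (m : M) :
    pureTensor f (∑ i ∈ A, s i) m = ∑ i ∈ A, pureTensor f (s i) m :=
  map_sum (AddMonoidHom.mk' (fun s => pureTensor f s m) fun s t => pureTensor_add_left f s t m) s A

theorem pureTensor_sum_right {ι : Type*} (A : Finset ι) (s : S) (m : ι → M) :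
    pureTensor f s (∑ i ∈ A, m i) = ∑ i ∈ A, pureTensor f s (m i) :=
  map_sum (AddMonoidHom.mk' (fun m => pureTensor f s m) fun m n => pureTensor_add_right f s m n) m A

theorem pureTensor_hom_ext {A : Type*} [AddCommMonoid A]
    {g h : (ModuleCat.extendScalars f).obj M →+ A}
    (H : ∀ s m, g (pureTensor f s m) = h (pureTensor f s m)) : g = h := by
  ext x
  induction x using TensorProduct.induction_on with
  | zero => exact (map_zero g).trans (map_zero h).symm
  | tmul s m => exact H s m
  | add x y hx hy =>
    exact ((map_add g x y).trans (congrArg₂ (· + ·) hx hy)).trans (map_add h x y).symm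

/-- The additive map on `S ⊗_R M` given by a balanced biadditive map. -/
def liftTensor {A : Type*} [AddCommMonoid A] (g : S →+ M →+ A)
    (hg : ∀ a s m, g (f a * s) m = g s (a • m)) : (ModuleCat.extendScalars f).obj M →+ A :=
  TensorProduct.liftAddHom (R := R)
    (M := (ModuleCat.restrictScalars f).obj (ModuleCat.of S S)) (N := M) g hg

end PureTensors

end FrobDescent
end

/-! ### Horizontal elements and operators built from p^{-e}-linear maps -/

noncomputable section

namespace FrobDescent

variable {R : Type u} [CommRing R]

/-- Subtracting multiplication by δ(1) from δ gives an operator that annihilates m. -/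
theorem IsHorizontal.smul_eq {p f : ℕ} {M : ModuleCat.{w} (diffOp R)} {m : M}
    (hm : IsHorizontal R p f m) {δ : diffOp R} (hδ : HasLevel R p f δ) :
    δ • m = ofRing R (δ.1 1) • m := by
  have h := hm (δ - ofRing R (δ.1 1)) (fun s x => ?_) ?_
  · rwa [sub_smul, sub_eq_zero] at h
  · change δ.1 (s ^ p ^ f * x) - δ.1 1 * (s ^ p ^ f * x) = s ^ p ^ f * (δ.1 x - δ.1 1 * x)
    rw [hδ]; ring
  · change δ.1 1 - δ.1 1 * 1 = 0
    ring

variable {p : ℕ} [Fact p.Prime] [CharP R p] {e : ℕ}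

section Operators

theorem diffOp_ext {δ ε : diffOp R} (h : ∀ a, δ.1 a = ε.1 a) : δ = ε :=
  Subtype.ext (LinearMap.ext h)

theorem mul_val_apply (δ ε : diffOp R) (a : R) : (δ * ε).1 a = δ.1 (ε.1 a) := rfl

theorem ofRing_val_apply (r a : R) : (ofRing R r).1 a = r * a := rfl

theorem one_val_apply (a : R) : (1 : diffOp R).1 a = a := rfl

theorem add_val_apply (δ ε : diffOp R) (a : R) : (δ + ε).1 a = δ.1 a + ε.1 a := rfl

theorem sum_val_apply {ι : Type*} (s : Finset ι) (δ : ι → diffOp R) (a : R) :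
    (∑ i ∈ s, δ i).1 a = ∑ i ∈ s, (δ i).1 a := by
  rw [AddSubmonoidClass.coe_finsetSum, LinearMap.sum_apply]

variable (hF : (frobenius R p).Finite) (l : R →+ R) (hl : ∀ a s, l (a ^ p ^ e * s) = a * l s)

/-- The operator `a ↦ l (δ (r * a ^ p ^ e))`, for a `p ^ (-e)`-linear map `l`. -/
def entry (δ : diffOp R) (r : R) : diffOp R :=
  ⟨(l.comp (δ.1.toAddMonoidHom.comp ((AddMonoidHom.mulLeft r).comp
    (iterateFrobenius R p e : R →+ R)))).toIntLinearMap, by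
    obtain ⟨f, hf⟩ := exists_hasLevel p δ
    refine mem_diffOp_of_pow_linear (p := p) (e := f) hF fun s y => ?_
    change l (δ.1 (r * (s ^ p ^ f * y) ^ p ^ e)) = s ^ p ^ f * l (δ.1 (r * y ^ p ^ e))
    rw [mul_pow, ← pow_mul, mul_comm (p ^ f), pow_mul, mul_left_comm, ← pow_mul, mul_comm (p ^ e),
      pow_mul, ← hl, ← pow_mul, ← pow_add, (hf.mono (Nat.le_add_right f e)) s, pow_add]⟩

theorem entry_apply (δ : diffOp R) (r a : R) :
    (entry hF l hl δ r).1 a = l (δ.1 (r * a ^ p ^ e)) := rfl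

theorem entry_hasLevel {f : ℕ} {δ : diffOp R} (hδ : HasLevel R p (e + f) δ) (r : R) :
    HasLevel R p f (entry hF l hl δ r) := by
  intro s x
  rw [entry_apply, entry_apply, ← hl, ← pow_mul, ← pow_add, add_comm f e, ← hδ, mul_pow,
    ← pow_mul, ← pow_add, add_comm f e, mul_left_comm]

/-- The operator `a ↦ δ (l a) ^ p ^ e`, for a `p ^ (-e)`-linear map `l`. -/
def conj (δ : diffOp R) : diffOp R :=
  ⟨((iterateFrobenius R p e : R →+ R).comp (δ.1.toAddMonoidHom.comp l)).toIntLinearMap, by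
    obtain ⟨f, hf⟩ := exists_hasLevel p δ
    refine mem_diffOp_of_pow_linear (p := p) (e := f + e) hF fun s y => ?_
    change δ.1 (l (s ^ p ^ (f + e) * y)) ^ p ^ e = s ^ p ^ (f + e) * δ.1 (l y) ^ p ^ e
    rw [pow_add, pow_mul, hl, hf, mul_pow]⟩

theorem conj_apply (δ : diffOp R) (a : R) : (conj hF l hl δ).1 a = δ.1 (l a) ^ p ^ e := rfl

/-- The values of `conj hF l hl 1` are q-th powers, over which δ is linear. -/
theorem mul_conj_one {δ : diffOp R} (hδ : HasLevel R p e δ) :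
    δ * conj hF l hl 1 = ofRing R (δ.1 1) * conj hF l hl 1 := diffOp_ext fun a => by
  rw [mul_val_apply, mul_val_apply, ofRing_val_apply, conj_apply, one_val_apply, mul_comm (δ.1 1),
    ← hδ, mul_one]

theorem isHorizontal_conj_one {M : ModuleCat.{w} (diffOp R)} (m : M) :
    IsHorizontal R p e (conj hF l hl 1 • m) := by
  intro δ hδ h1
  rw [← mul_smul, mul_conj_one hF l hl hδ, h1, map_zero, zero_mul, zero_smul]

variable (B : DualBasis (iterateFrobenius R p e))

theorem DualBasis.coord_pow_mul (i : Fin B.card) (a s : R) :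
    B.coord i (a ^ p ^ e * s) = a * B.coord i s := B.coord_mul i a s

/-- The dual basis identity inside D_R; applied to m, it expands m in horizontal elements
(`isHorizontal_conj_one`). -/
theorem DualBasis.sum_gen_mul_conj :
    ∑ i, ofRing R (B.gen i) * conj hF (B.coord i) (B.coord_pow_mul i) 1 = 1 := diffOp_ext fun a => by
  rw [sum_val_apply, one_val_apply]
  conv_rhs => rw [← B.sum_coord a]
  exact Finset.sum_congr rfl fun i _ => mul_comm _ _

end Operators

/-! ### The matrix action on the pullback -/

section Action

variable (hF : (frobenius R p).Finite) (B : DualBasis (iterateFrobenius R p e))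
  {M : ModuleCat.{w} (diffOp R)}

variable (p e) in
/-- The `R`-module `F^{e*} M`. -/
abbrev Pullback (M : ModuleCat.{w} (diffOp R)) : ModuleCat.{max w u} R :=
  (ModuleCat.extendScalars (iterateFrobenius R p e)).obj ((toRMod R).obj M)

variable (p e) in
/-- The tensor `r ⊗ m` in `F^{e*} M`. -/
def tens (r : R) (m : M) : Pullback p e M :=
  pureTensor (iterateFrobenius R p e) (M := (toRMod R).obj M) r m

theorem tens_add_right (r : R) (m n : M) : tens p e r (m + n) = tens p e r m + tens p e r n :=
  pureTensor_add_right (M := (toRMod R).obj M) _ _ _ _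

theorem tens_sum_left {ι : Type*} (A : Finset ι) (r : ι → R) (m : M) :
    tens p e (∑ i ∈ A, r i) m = ∑ i ∈ A, tens p e (r i) m :=
  pureTensor_sum_left _ _ _ _

theorem tens_sum_right {ι : Type*} (A : Finset ι) (r : R) (m : ι → M) :
    tens p e r (∑ i ∈ A, m i) = ∑ i ∈ A, tens p e r (m i) :=
  pureTensor_sum_right (M := (toRMod R).obj M) _ _ _ _

theorem tens_smul (r a : R) (m : M) : tens p e r (ofRing R a • m) = tens p e (a ^ p ^ e * r) m :=
  (pureTensor_map_mul (iterateFrobenius R p e) (M := (toRMod R).obj M) a r m).symm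

theorem DualBasis.sum_tens (r : R) (m : M) :
    ∑ i, tens p e (B.gen i) (ofRing R (B.coord i r) • m) = tens p e r m := by
  conv_rhs => rw [← B.sum_coord r, tens_sum_left]
  exact Finset.sum_congr rfl fun i _ => tens_smul _ _ _

/-- The action of a differential operator on the tensors `r ⊗ m` with fixed `r`. -/
def actTens (δ : diffOp R) (r : R) : M →+ Pullback p e M :=
  AddMonoidHom.mk'
    -- Modelled on M = R, where δ(r a^q) = ∑ x_i l_i(δ(r a^q))^q.
    (fun m => ∑ i, tens p e (B.gen i) (entry hF (B.coord i) (B.coord_pow_mul i) δ r • m))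
    fun m n => by simp only [smul_add, tens_add_right, Finset.sum_add_distrib]

/-- The action of a differential operator on `F^{e*} M`. -/
def act (δ : diffOp R) : Pullback p e M →+ Pullback p e M :=
  liftTensor (iterateFrobenius R p e) (M := (toRMod R).obj M)
    (AddMonoidHom.mk' (fun r => actTens hF B δ r)
      fun r s => by
        refine AddMonoidHom.ext fun (m : M) => ?_
        change ∑ i, tens p e (B.gen i) _ = ∑ i, tens p e (B.gen i) _ + ∑ i, tens p e (B.gen i) _
        rw [← Finset.sum_add_distrib]
        refine Finset.sum_congr rfl fun i _ => ?_
        rw [← tens_add_right, ← add_smul]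
        congr 2
        refine diffOp_ext fun a => ?_
        rw [add_val_apply, entry_apply, entry_apply, entry_apply, add_mul, map_add, map_add])
    (fun a r (m : M) => by
      change ∑ i, tens p e (B.gen i) _ = ∑ i, tens p e (B.gen i) (_ • ofRing R a • m)
      refine Finset.sum_congr rfl fun i _ => ?_
      rw [← mul_smul]
      congr 2
      refine diffOp_ext fun b => ?_
      rw [mul_val_apply, entry_apply, entry_apply, ofRing_val_apply, iterateFrobenius_def, mul_pow,
        mul_assoc, mul_left_comm])

theorem act_tens (δ : diffOp R) (r : R) (m : M) : act hF B δ (tens p e r m) =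
    ∑ i, tens p e (B.gen i) (entry hF (B.coord i) (B.coord_pow_mul i) δ r • m) := rfl

theorem tens_hom_ext {A : Type*} [AddCommMonoid A] {g h : Pullback p e M →+ A}
    (H : ∀ r m, g (tens p e r m) = h (tens p e r m)) : g = h :=
  pureTensor_hom_ext _ H

/-- An operator whose values at `r * a ^ p ^ e` are `s * δ a ^ p ^ e` maps `r ⊗ m` to
`s ⊗ δ m`. -/
theorem act_tens_of_forall {ε : diffOp R} {r s : R} (δ : diffOp R)
    (h : ∀ a, ε.1 (r * a ^ p ^ e) = s * δ.1 a ^ p ^ e) (m : M) :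
    act hF B ε (tens p e r m) = tens p e s (δ • m) := by
  rw [act_tens, ← B.sum_tens]
  refine Finset.sum_congr rfl fun i _ => ?_
  rw [← mul_smul]
  congr 2
  refine diffOp_ext fun a => ?_
  rw [entry_apply, h, mul_val_apply, ofRing_val_apply, mul_comm s, mul_comm (B.coord i s)]
  exact B.coord_pow_mul i _ _

/-- Matrix multiplication: summing over the intermediate index reassembles ε(r a^q) from its
coordinates. -/
theorem act_mul (δ ε : diffOp R) (x : Pullback p e M) :
    act hF B (δ * ε) x = act hF B δ (act hF B ε x) := by
  refine DFunLike.congr_fun (f := act hF B (δ * ε)) (g := (act hF B δ).comp (act hF B ε))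
    (tens_hom_ext fun r m => ?_) x
  rw [AddMonoidHom.comp_apply, act_tens, act_tens, map_sum]
  simp only [act_tens]
  rw [Finset.sum_comm]
  refine Finset.sum_congr rfl fun j _ => ?_
  rw [← tens_sum_right]
  simp only [← mul_smul]
  rw [← Finset.sum_smul]
  congr 2
  refine diffOp_ext fun a => ?_
  rw [sum_val_apply, entry_apply, mul_val_apply]
  simp only [mul_val_apply, entry_apply]
  rw [← map_sum, ← map_sum]
  conv_lhs => rw [← B.sum_coord (ε.1 (r * a ^ p ^ e))]
  congr 2
  exact Finset.sum_congr rfl fun i _ => mul_comm _ _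

theorem act_add (δ ε : diffOp R) (x : Pullback p e M) :
    act hF B (δ + ε) x = act hF B δ x + act hF B ε x := by
  refine DFunLike.congr_fun (f := act hF B (δ + ε)) (g := act hF B δ + act hF B ε)
    (tens_hom_ext fun r m => ?_) x
  rw [AddMonoidHom.add_apply, act_tens, act_tens, act_tens, ← Finset.sum_add_distrib]
  refine Finset.sum_congr rfl fun i _ => ?_
  rw [← tens_add_right, ← add_smul]
  congr 2
  refine diffOp_ext fun a => ?_
  rw [add_val_apply, entry_apply, entry_apply, entry_apply, add_val_apply, map_add]

theorem act_ofRing (s : R) (x : Pullback p e M) : act hF B (ofRing R s) x = s • x := by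
  refine DFunLike.congr_fun (f := act hF B (ofRing R s))
    (g := (DistribSMul.toAddMonoidHom (Pullback p e M) s))
    (tens_hom_ext fun r m => ?_) x
  rw [act_tens_of_forall hF B (s := s * r) 1, one_smul]
  · rfl
  · intro a
    rw [ofRing_val_apply, one_val_apply, mul_assoc]

/-- The `D_R`-module structure on `F^{e*} M`. -/
abbrev actModule (M : ModuleCat.{w} (diffOp R)) : Module (diffOp R) (Pullback p e M) where
  smul δ x := act hF B δ x
  one_smul x := by
    change act hF B 1 x = x
    rw [← map_one (ofRing R), act_ofRing, one_smul]
  mul_smul := act_mul hF B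
  smul_zero δ := map_zero (act hF B δ)
  smul_add δ := map_add (act hF B δ)
  add_smul := act_add hF B
  zero_smul x := by
    change act hF B 0 x = 0
    rw [← map_zero (ofRing R), act_ofRing, zero_smul]

end Action

/-! ### Existence, uniqueness and functoriality -/

section Natural

/-- The natural structure on `F^{e*} M` defined by a dual basis. -/
def naturalStructure (hF : (frobenius R p).Finite) (B : DualBasis (iterateFrobenius R p e))
    (M : ModuleCat.{max u v} (diffOp R)) : NaturalStructure.{u, v} R p e M where
  toModule := actModule hF B M
  ofRing_smul := act_ofRing hF B
  smul_tensor f δ r m hδ hm := by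
    change act hF B δ (tens p e r m) = tens p e (δ.1 r) m
    rw [act_tens, ← B.sum_tens]
    refine Finset.sum_congr rfl fun i _ => ?_
    -- The entries have level f, so on T^f(M) they act through their values l_i(δ(r)) at 1.
    rw [hm.smul_eq (entry_hasLevel hF _ _ hδ r), entry_apply, one_pow, mul_one]

/-- If δ has level f, expanding m by a dual basis of F^f leaves only tensors on which the action is
prescribed. -/
theorem NaturalStructure.eq {M : ModuleCat.{max u v} (diffOp R)} (hF : (frobenius R p).Finite)
    (C : ∀ f, DualBasis (iterateFrobenius R p f)) (S T : NaturalStructure.{u, v} R p e M) :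
    S = T := by
  refine NaturalStructure.ext (Module.ext' _ _ fun δ x => ?_)
  obtain ⟨f, hf⟩ := exists_hasLevel p δ
  have hδ : HasLevel R p (e + f) δ := hf.mono (Nat.le_add_left f e)
  let act (S : NaturalStructure.{u, v} R p e M) : Pullback p e M →+ Pullback p e M :=
    AddMonoidHom.mk' (fun x => S.toModule.smul δ x) (fun x y =>
      let := S.toModule
      smul_add δ x y)
  have hact : ∀ (S : NaturalStructure.{u, v} R p e M) (r : R) (m : M),
      act S (tens p e r m) = ∑ i, tens p e (δ.1 ((C f).gen i ^ p ^ e * r))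
        (conj hF ((C f).coord i) ((C f).coord_pow_mul i) 1 • m) := by
    intro S r m
    conv_lhs => rw [← one_smul (diffOp R) m, ← (C f).sum_gen_mul_conj hF, Finset.sum_smul,
      tens_sum_right, map_sum]
    refine Finset.sum_congr rfl fun i _ => ?_
    rw [mul_smul, tens_smul]
    exact S.smul_tensor f δ _ _ hδ (isHorizontal_conj_one hF _ _ _)
  exact DFunLike.congr_fun (tens_hom_ext fun r m => (hact S r m).trans (hact T r m).symm) x

theorem isFunctorial_naturalStructure (hF : (frobenius R p).Finite)
    (B : DualBasis (iterateFrobenius R p e)) :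
    IsFunctorial (naturalStructure.{u, v} (e := e) hF B) := by
  intro M M' φ δ x
  let F : Pullback p e M →+ Pullback p e M' :=
    (((frobPullback.{u, v} R p e).map ((toRMod R).map φ)).hom).toAddMonoidHom
  have hF' : ∀ r m, F (tens p e r m) = tens p e r (φ.hom m) := fun r m => rfl
  refine DFunLike.congr_fun (f := F.comp (act hF B δ)) (g := (act hF B δ).comp F)
    (tens_hom_ext fun r m => ?_) x
  rw [AddMonoidHom.comp_apply, AddMonoidHom.comp_apply, hF', act_tens, act_tens, map_sum]
  refine Finset.sum_congr rfl fun i _ => ?_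
  rw [hF', map_smul]

end Natural

end FrobDescent
end

noncomputable section

namespace FrobDescent

/-! ### Descent by the splitting projector -/

section Equivalence

variable {R : Type u} [CommRing R] {p : ℕ} [Fact p.Prime] [CharP R p] {e : ℕ}
  (hF : (frobenius R p).Finite) (B : DualBasis (iterateFrobenius R p e))
  (σ : R →+ R) (hσ : ∀ a s, σ (a ^ p ^ e * s) = a * σ s) (hσ1 : σ 1 = 1)

/-- The additive map `r ⊗ m ↦ σ r • m` on `F^{e*} M`, for a `p ^ (-e)`-linear map `σ`. -/
def retract (M : ModuleCat.{w} (diffOp R)) : Pullback p e M →+ M :=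
  liftTensor (iterateFrobenius R p e) (M := (toRMod R).obj M)
    (AddMonoidHom.mk' (fun r => (DistribSMul.toAddMonoidHom M (ofRing R (σ r)) : M →+ M))
      fun r s => AddMonoidHom.ext fun (m : M) => by
        change ofRing R (σ (r + s)) • m = ofRing R (σ r) • m + ofRing R (σ s) • m
        rw [map_add, map_add, add_smul])
    (fun a r (m : M) => by
      change ofRing R (σ (a ^ p ^ e * r)) • m = ofRing R (σ r) • ofRing R a • m
      rw [hσ, ← mul_smul, ← map_mul, mul_comm])

theorem retract_tens {M : ModuleCat.{w} (diffOp R)} (r : R) (m : M) :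
    retract σ hσ M (tens p e r m) = ofRing R (σ r) • m := rfl

theorem retract_tens_one (hσ1 : σ 1 = 1) {M : ModuleCat.{w} (diffOp R)} (m : M) :
    retract σ hσ M (tens p e 1 m) = m := by
  rw [retract_tens, hσ1, map_one, one_smul]

/-- Comes from σ(r a^q) = σ(r) a. It shows that `conj` transports the action on M to the tensors 1 ⊗
m, and that π maps onto these. -/
theorem act_conj {M : ModuleCat.{w} (diffOp R)} (δ : diffOp R) (x : Pullback p e M) :
    act hF B (conj hF σ hσ δ) x = tens p e 1 (δ • retract σ hσ M x) := by
  refine DFunLike.congr_fun (f := act hF B (conj hF σ hσ δ))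
    (g := AddMonoidHom.mk' (fun x => tens p e 1 (δ • retract σ hσ M x)) fun x y => by
      rw [map_add, smul_add, tens_add_right]) (tens_hom_ext fun r m => ?_) x
  rw [AddMonoidHom.mk'_apply, retract_tens, ← mul_smul]
  refine act_tens_of_forall hF B _ (fun a => ?_) m
  rw [conj_apply, mul_comm r, hσ, mul_val_apply, ofRing_val_apply, one_mul, mul_comm a]

theorem tens_eq_act_ofRing {M : ModuleCat.{w} (diffOp R)} (r : R) (m : M) :
    tens p e r m = act hF B (ofRing R r) (tens p e 1 m) := by
  rw [act_ofRing]
  exact congrArg (fun s => tens p e s m) (mul_one r).symm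

variable (N : ModuleCat.{w} (diffOp R))

/-- Uses σ(b^q) = b, which follows from σ(1) = 1. -/
theorem conj_mul (hσ1 : σ 1 = 1) (δ ε : diffOp R) :
    conj hF σ hσ (δ * ε) = conj hF σ hσ δ * conj hF σ hσ ε := diffOp_ext fun a => by
  rw [mul_val_apply, conj_apply, conj_apply, conj_apply, mul_val_apply,
    ← mul_one ((ε.1 (σ a)) ^ p ^ e), hσ, hσ1, mul_one]

theorem conj_add (δ ε : diffOp R) :
    conj hF σ hσ (δ + ε) = conj hF σ hσ δ + conj hF σ hσ ε := diffOp_ext fun a => by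
  rw [add_val_apply, conj_apply, conj_apply, conj_apply, add_val_apply]
  exact map_add (iterateFrobenius R p e) _ _

theorem conj_ofRing (r : R) :
    conj hF σ hσ (ofRing R r) = ofRing R (r ^ p ^ e) * conj hF σ hσ 1 := diffOp_ext fun a => by
  rw [mul_val_apply, conj_apply, conj_apply, ofRing_val_apply, ofRing_val_apply, one_val_apply,
    mul_pow]

/-- The image of the projector `a ↦ σ a ^ p ^ e` on `N`. -/
def fixedPart : AddSubgroup N where
  carrier := {n | conj hF σ hσ 1 • n = n}
  add_mem' := by
    intro m n (hm : _ = _) (hn : _ = _)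
    change _ = _
    rw [smul_add, hm, hn]
  zero_mem' := smul_zero _
  neg_mem' := by
    intro m (hm : _ = _)
    change _ = _
    rw [smul_neg, hm]

/-- Values of `conj` are q-th powers, which π fixes. Allowing any l puts all dual basis components
in the descent. -/
theorem smul_mem_fixedPart (hσ1 : σ 1 = 1) (l : R →+ R)
    (hl : ∀ a s, l (a ^ p ^ e * s) = a * l s) (δ : diffOp R) (n : N) :
    conj hF l hl δ • n ∈ fixedPart hF σ hσ N := by
  change _ = _
  rw [← mul_smul]
  congr 1
  refine diffOp_ext fun a => ?_
  rw [mul_val_apply, conj_apply, conj_apply, one_val_apply, ← mul_one (δ.1 (l a) ^ p ^ e), hσ, hσ1,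
    mul_one, mul_one]

/-- The descended `D_R`-module structure, in which `δ` acts as `a ↦ δ (σ a) ^ p ^ e`. -/
abbrev fixedPartModule (hσ1 : σ 1 = 1) : Module (diffOp R) (fixedPart hF σ hσ N) where
  smul δ n := ⟨conj hF σ hσ δ • n.1, smul_mem_fixedPart hF σ hσ N hσ1 σ hσ δ n.1⟩
  one_smul n := Subtype.ext n.2
  mul_smul δ ε n := Subtype.ext (by
    change conj hF σ hσ (δ * ε) • n.1 = conj hF σ hσ δ • conj hF σ hσ ε • n.1
    rw [conj_mul hF σ hσ hσ1, mul_smul])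
  smul_zero δ := Subtype.ext (smul_zero (conj hF σ hσ δ))
  smul_add δ m n := Subtype.ext (smul_add (conj hF σ hσ δ) m.1 n.1)
  add_smul δ ε n := Subtype.ext (by
    change conj hF σ hσ (δ + ε) • n.1 = conj hF σ hσ δ • n.1 + conj hF σ hσ ε • n.1
    rw [conj_add, add_smul])
  zero_smul n := Subtype.ext (by
    change conj hF σ hσ 0 • n.1 = 0
    rw [← map_zero (ofRing R), conj_ofRing, zero_pow (pow_pos (Fact.out : p.Prime).pos e).ne',
      map_zero, zero_mul, zero_smul])

/-- The descent of `N` along `F^e`. -/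
def descent : ModuleCat.{w} (diffOp R) :=
  let := fixedPartModule hF σ hσ N hσ1
  ModuleCat.of (diffOp R) (fixedPart hF σ hσ N)

/-- The inclusion of the descent of `N` into `N`. -/
def descentVal : descent hF σ hσ hσ1 N →+ N := (fixedPart hF σ hσ N).subtype

theorem descentVal_injective : Function.Injective (descentVal hF σ hσ hσ1 N) :=
  Subtype.val_injective

theorem descentVal_smul (δ : diffOp R) (n : descent hF σ hσ hσ1 N) :
    descentVal hF σ hσ hσ1 N (δ • n) = conj hF σ hσ δ • descentVal hF σ hσ hσ1 N n := rfl

theorem conj_one_smul_descentVal (n : descent hF σ hσ hσ1 N) :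
    conj hF σ hσ 1 • descentVal hF σ hσ hσ1 N n = descentVal hF σ hσ hσ1 N n := n.2

theorem exists_descentVal_eq (l : R →+ R) (hl : ∀ a s, l (a ^ p ^ e * s) = a * l s) (n : N) :
    ∃ m, descentVal hF σ hσ hσ1 N m = conj hF l hl 1 • n :=
  ⟨⟨_, smul_mem_fixedPart hF σ hσ N hσ1 l hl 1 n⟩, rfl⟩

/-- The map `r ⊗ n ↦ r • n` from the pullback of the descent of `N` to `N`. -/
def counit : Pullback p e (descent hF σ hσ hσ1 N) →+ N :=
  liftTensor (iterateFrobenius R p e) (M := (toRMod R).obj (descent hF σ hσ hσ1 N))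
    (AddMonoidHom.mk' (fun r => (DistribSMul.toAddMonoidHom N (ofRing R r) : N →+ N).comp
        (descentVal hF σ hσ hσ1 N))
      fun r s => AddMonoidHom.ext fun (m : descent hF σ hσ hσ1 N) => by
        change ofRing R (r + s) • descentVal hF σ hσ hσ1 N m =
          ofRing R r • descentVal hF σ hσ hσ1 N m + ofRing R s • descentVal hF σ hσ hσ1 N m
        rw [map_add, add_smul])
    (fun a r (m : descent hF σ hσ hσ1 N) => by
      change ofRing R (a ^ p ^ e * r) • descentVal hF σ hσ hσ1 N m =
        ofRing R r • descentVal hF σ hσ hσ1 N (ofRing R a • m)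
      rw [descentVal_smul, conj_ofRing, mul_smul, conj_one_smul_descentVal, ← mul_smul, ← map_mul,
        mul_comm])

theorem counit_tens (r : R) (m : descent hF σ hσ hσ1 N) :
    counit hF σ hσ hσ1 N (tens p e r m) = ofRing R r • descentVal hF σ hσ hσ1 N m := rfl

theorem counit_act (δ : diffOp R) (x : Pullback p e (descent hF σ hσ hσ1 N)) :
    counit hF σ hσ hσ1 N (act hF B δ x) = δ • counit hF σ hσ hσ1 N x := by
  refine DFunLike.congr_fun (f := (counit hF σ hσ hσ1 N).comp (act hF B δ))
    (g := (DistribSMul.toAddMonoidHom N δ : N →+ N).comp (counit hF σ hσ hσ1 N))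
    (tens_hom_ext fun r m => ?_) x
  change counit hF σ hσ hσ1 N (act hF B δ (tens p e r m)) =
    δ • counit hF σ hσ hσ1 N (tens p e r m)
  rw [act_tens, map_sum]
  simp only [counit_tens, descentVal_smul, ← mul_smul]
  -- The two operators need agree only after composition with π, which reduces to arguments σ(a)^q.
  rw [← Finset.sum_smul, ← conj_one_smul_descentVal hF σ hσ hσ1 N m]
  simp only [← mul_smul]
  congr 1
  refine diffOp_ext fun a => ?_
  simp only [mul_val_apply, sum_val_apply, conj_apply, ofRing_val_apply, entry_apply, one_val_apply]
  have h : σ (σ a ^ p ^ e) = σ a := by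
    rw [← mul_one (σ a ^ p ^ e), hσ, hσ1, mul_one]
  rw [h]
  conv_rhs => rw [← B.sum_coord (δ.1 (r * σ a ^ p ^ e))]
  exact Finset.sum_congr rfl fun i _ => mul_comm _ _

/-- The inverse is n ↦ ∑ x_i ⊗ n_i, with n_i the image of n under a ↦ l_i(a)^q. -/
theorem counit_bijective (B : DualBasis (iterateFrobenius R p e)) :
    Function.Bijective (counit hF σ hσ hσ1 N) := by
  choose g hg using fun i => exists_descentVal_eq hF σ hσ hσ1 N (B.coord i) (B.coord_pow_mul i)
  refine Function.bijective_iff_has_inverse.2 ⟨fun n => ∑ i, tens p e (B.gen i) (g i n), ?_, ?_⟩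
  · have hadd : ∀ i m n, g i (m + n) = g i m + g i n := fun i m n =>
      descentVal_injective hF σ hσ hσ1 N (by rw [map_add, hg, hg, hg, smul_add])
    let G : N →+ Pullback p e (descent hF σ hσ hσ1 N) :=
      AddMonoidHom.mk' (fun n => ∑ i, tens p e (B.gen i) (g i n)) fun m n => by
        simp only [hadd, tens_add_right, Finset.sum_add_distrib]
    refine fun x => DFunLike.congr_fun (f := G.comp (counit hF σ hσ hσ1 N))
      (g := AddMonoidHom.id _) (tens_hom_ext fun r m => ?_) x
    change ∑ i, tens p e (B.gen i) (g i (counit hF σ hσ hσ1 N (tens p e r m))) = tens p e r m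
    conv_rhs => rw [← B.sum_tens r m]
    refine Finset.sum_congr rfl fun i _ => congrArg _ (descentVal_injective hF σ hσ hσ1 N ?_)
    rw [hg, counit_tens, descentVal_smul, ← conj_one_smul_descentVal hF σ hσ hσ1 N m]
    simp only [← mul_smul]
    congr 1
    refine diffOp_ext fun a => ?_
    simp only [mul_val_apply, conj_apply, ofRing_val_apply, one_val_apply]
    rw [mul_comm r, B.coord_pow_mul, mul_comm, ← mul_one (σ a ^ p ^ e), hσ, hσ1, mul_one]
  · intro n
    rw [map_sum]
    simp only [counit_tens, hg, ← mul_smul]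
    rw [← Finset.sum_smul, B.sum_gen_mul_conj, one_smul]

theorem isEquivalence_frobFunctor :
    (frobFunctor _ (isFunctorial_naturalStructure.{u, v} hF B)).IsEquivalence where
  faithful := ⟨fun {M M' φ ψ} h => by
    ext m
    have h1 : tens p e 1 (φ.hom m) = tens p e 1 (ψ.hom m) :=
      congrArg (fun g => g.hom (tens p e 1 m : Pullback p e M)) h
    obtain ⟨σ, hσ, hσ1⟩ := B.exists_splitting
    rw [← retract_tens_one σ hσ hσ1 (φ.hom m), h1, retract_tens_one σ hσ hσ1]⟩
  full := ⟨fun {M M'} g => by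
    obtain ⟨σ, hσ, hσ1⟩ := B.exists_splitting
    let G : Pullback p e M →+ Pullback p e M' := g.hom.toAddMonoidHom
    have hG : ∀ δ x, G (act hF B δ x) = act hF B δ (G x) := fun δ x => g.hom.map_smul δ x
    have hone : ∀ (M : ModuleCat.{max u v} (diffOp R)) (δ : diffOp R) (m : M),
        tens p e 1 (δ • m) = act hF B (conj hF σ hσ δ) (tens p e 1 m) := fun M δ m => by
      rw [act_conj, retract_tens_one σ hσ hσ1]
    let φ : M →ₗ[diffOp R] M' :=
      { toFun := fun m => retract σ hσ M' (G (tens p e 1 m))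
        map_add' := fun m n => by rw [tens_add_right, map_add, map_add]
        map_smul' := fun δ m => by
          rw [hone, hG, act_conj, retract_tens_one σ hσ hσ1, RingHom.id_apply] }
    -- As π fixes 1 ⊗ m and commutes with G, the image G(1 ⊗ m) is again of the form 1 ⊗ m'.
    have hφ : ∀ m, tens p e 1 (φ m) = G (tens p e 1 m) := fun m => by
      have h := hone M 1 m
      rw [one_smul] at h
      rw [h, hG, act_conj, one_smul]
      rfl
    refine ⟨ModuleCat.ofHom φ, ModuleCat.hom_ext (LinearMap.ext fun x => ?_)⟩
    let Φ : Pullback p e M →+ Pullback p e M' :=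
      ((frobFunctor _ (isFunctorial_naturalStructure.{u, v} hF B)).map
        (ModuleCat.ofHom φ)).hom.toAddMonoidHom
    refine DFunLike.congr_fun (f := Φ) (g := G) (tens_hom_ext fun r m => ?_) x
    change tens p e r (φ m) = _
    rw [tens_eq_act_ofRing hF B, hφ, ← hG, ← tens_eq_act_ofRing hF B]⟩
  essSurj := ⟨fun N => by
    obtain ⟨σ, hσ, hσ1⟩ := B.exists_splitting
    let D := descent hF σ hσ hσ1 N
    let f : (frobFunctor _ (isFunctorial_naturalStructure.{u, v} hF B)).obj D →ₗ[diffOp R] N :=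
      { toFun := counit hF σ hσ hσ1 N
        map_add' := map_add (counit hF σ hσ hσ1 N)
        map_smul' := counit_act hF B σ hσ hσ1 N }
    exact ⟨D, ⟨(LinearEquiv.ofBijective f (counit_bijective hF σ hσ hσ1 N B)).toModuleIso⟩⟩⟩

end Equivalence

end FrobDescent
end

theorem mainTheorem5 (R : Type u) [CommRing R] (p : ℕ) [Fact p.Prime] [CharP R p]
    [IsRegularRing R] (hF : (frobenius R p).Finite) (e : ℕ) :
    ∃ S : ∀ M : ModuleCat.{max u v} (FrobDescent.diffOp R),
        FrobDescent.NaturalStructure.{u, v} R p e M,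
      (∀ M (T : FrobDescent.NaturalStructure.{u, v} R p e M), T = S M) ∧
      ∃ hS : FrobDescent.IsFunctorial S, (FrobDescent.frobFunctor S hS).IsEquivalence := by
  have hflat := FrobDescent.frobenius_flat R p hF
  have C := fun f => (FrobDescent.nonempty_dualBasis
    (FrobDescent.iterateFrobenius_finite R p hF f)
    (FrobDescent.iterateFrobenius_flat R p hflat f)).some
  exact ⟨FrobDescent.naturalStructure hF (C e), fun M T => T.eq hF C _,
    FrobDescent.isFunctorial_naturalStructure hF (C e),
    FrobDescent.isEquivalence_frobFunctor hF (C e)⟩
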